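/- **Setting.** There are $n$ EVs, $m$ charging stations and time slots $1,\dots,T$. EV $i$ is assigned to station $P(i)$ and has value $v_i\ge 0$, demand $D_i>0$, maximum charging rate $k_i>0$ and an integer deadline $d_i\le T$. Station $j$ has a local peak cap $C_j>0$, and there is a global peak cap $C_{\rm total}>0$. The slackness parameter $s\ge 1$ satisfies $D_i\le k_id_i/s$ for all $i$. Let $K_j=\max_{P(i)=j}k_i$ (and $K_j=0$ if no EV is at station $j$). A *schedule* is a set $S$ of selected EVs with amounts $y_i(t)\ge 0$ such that $y_i(t)=0$ for $t>d_i$, $y_i(t)\le k_i$, and $\sum_t y_i(t)$ equals $D_i$ if $i\in S$ and $0$ otherwise. It is *feasible* if moreover $W(t,j):=\sum_{i:P(i)=j}y_i(t)\le C_j$ and $\sum_i y_i(t)\le C_{\rm total}$ for all $t,j$. Its *revenue* is $\sum_{i\in S}v_i$; the problem is to maximize the revenue over feasible schedules. Its *linear relaxation* maximizes $\sum_i\frac{v_i}{D_i}\sum_t y_i(t)$ over all $y\ge 0$ with $y_i(t)=0$ for $t>d_i$, $\sum_t y_i(t)\le D_i$, $y_i(t)\le\frac{k_i}{D_i}\sum_{t'}y_i(t')$,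 and the same local and global caps. **The algorithm SCS.** Let $\bar W(t,j)$ denote the load still available at station $j$ in slot $t$ under the current schedule; two rules are considered: (G) $\bar W(t,j)=\min\{C_j-W(t,j),\,C_{\rm total}-\sum_i y_i(t)\}$; (L) $\bar W(t,j)=C_j-W(t,j)$. (If $\sum_jC_j\le C_{\rm total}$, the two rules agree on every $y$ that respects the local caps.) Order the EVs so that $v_1/D_1\ge v_2/D_2\ge\dots\ge v_n/D_n$, ties in any way, and start with the empty schedule. *SmartAllocate*$(i)$: select $i$; go through the slots $t\le d_i$ in decreasing order of $\bar W(t,P(i))$, later slots first among equals, and allocate $\min\{k_i,\bar W(t,P(i))\}$ to EV $i$ in slot $t$, until its demand $D_i$ is fully allocated (the last amount being cut off so that the total is $D_i$). *Phase 1*: for $i=1,\dots,n$, if $\sum_{t\le d_i}\min\{\bar W(t,P(i)),k_i\}\ge D_i$, call SmartAllocate$(i)$. *Phase 2*: for $i=1,\dots,n$, if $i$ is not selected, do the following. Put $L=\emptyset$, $v_{\rm inc}=v_i$, $\delta(t)=\min\{k_i,\bar W(t,P(i))\}$. For $i'=i-1,\dots,1$: if $i'$ is selected, $P(i')=P(i)$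 and $v_{\rm inc}-v_{i'}>0$, add $i'$ to $L$, replace $v_{\rm inc}$ by $v_{\rm inc}-v_{i'}$ and $\delta(t)$ by $\min\{k_i,\delta(t)+y_{i'}(t)\}$. Then, if $\sum_{t\le d_i}\delta(t)\ge D_i$, remove the EVs of $L$ from the schedule and call SmartAllocate$(i)$. **Theorem.** Assume $s>1$ and $K_j<C_j$ for all $j$, and put $$\rho=1+\sum_{j=1}^m\frac{C_j}{C_j-K_j}\cdot\frac{s}{s-1}.$$ 1. If $k_i\le C_{\rm total}$ for all $i$, then SCS with rule (G) is a $\rho$-approximation: its output is a feasible schedule, and the revenue of every feasible schedule, as well as the objective value of every feasible solution of the linear relaxation, is at most $\rho$ times the total value of the EVs that SCS selects. 2. SCS with rule (L) outputs a schedule that respects all local caps, and that is feasible if $\sum_jC_j\le C_{\rm total}$. The revenue of every feasible schedule, as well as the objective value of every feasible solution of the linear relaxation, is at most $\rho$ times the total value of the EVs that SCS selects (whether or not $\sum_jC_j\le C_{\rm total}$). -/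

import Mathlib

open scoped BigOperators

noncomputable section

namespace EVCharging

/-- An instance with `n` EVs, `m` stations and `T` time slots. The slots `1, …, T` are represented
by `t : Fin T`, where `t` stands for the slot with number `t + 1`. -/
structure Instance (n m T : ℕ) where
  /-- station of each EV -/
  P : Fin n → Fin m
  /-- value of each EV -/
  v : Fin n → ℝ
  /-- charging demand of each EV -/
  D : Fin n → ℝ
  /-- maximum charging rate of each EV -/
  k : Fin n → ℝ
  /-- deadline of each EV: it can be charged in the slots with number at most `d i` -/
  d : Fin n → ℕ
  /-- local peak caps -/
  C : Fin m → ℝ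
  /-- global peak cap -/
  Ctotal : ℝ
  /-- slackness parameter -/
  s : ℝ
  v_nonneg : ∀ i, 0 ≤ v i
  D_pos : ∀ i, 0 < D i
  k_pos : ∀ i, 0 < k i
  d_le : ∀ i, d i ≤ T
  C_pos : ∀ j, 0 < C j
  Ctotal_pos : 0 < Ctotal
  one_le_s : 1 ≤ s
  slack : ∀ i, D i ≤ k i * d i / s

/-- A set of selected EVs together with the charging amounts `rate i t`. -/
structure Schedule (n T : ℕ) where
  selected : Finset (Fin n)
  rate : Fin n → Fin T → ℝ

namespace Schedule

variable {n T : ℕ}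

/-- Nothing is selected, nothing is charged. -/
def empty : Schedule n T := ⟨∅, fun _ _ => 0⟩

/-- Unselect the EVs in `L` and free the resources that they use. -/
def remove (x : Schedule n T) (L : Finset (Fin n)) : Schedule n T :=
  ⟨x.selected \ L, fun i t => if i ∈ L then 0 else x.rate i t⟩

end Schedule

namespace Instance

variable {n m T : ℕ} (I : Instance n m T)

/-- `K j` is the largest maximum charging rate among the EVs at station `j`
(and `0` if there is no EV at station `j`). -/
def K (j : Fin m) : ℝ := ⨆ i : {i : Fin n // I.P i = j}, I.k i

/-- The slot `t` is not after the deadline of EV `i`. -/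
def InWindow (i : Fin n) (t : Fin T) : Prop := (t : ℕ) + 1 ≤ I.d i

instance (i : Fin n) (t : Fin T) : Decidable (I.InWindow i t) :=
  inferInstanceAs (Decidable ((t : ℕ) + 1 ≤ I.d i))

/-! ### The scheduling problem -/

/-- Total workload `W(t, j)` at station `j` in slot `t`. -/
def load (y : Fin n → Fin T → ℝ) (t : Fin T) (j : Fin m) : ℝ :=
  ∑ i with I.P i = j, y i t

/-- The constraints on the individual EVs: charging takes place before the deadline, the rate limits
are respected, selected EVs get exactly their demand and the other EVs get nothing. -/
structure ServesSelected (x : Schedule n T) : Prop where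
  nonneg : ∀ i t, 0 ≤ x.rate i t
  deadline : ∀ i t, ¬ I.InWindow i t → x.rate i t = 0
  rate_le : ∀ i t, x.rate i t ≤ I.k i
  total : ∀ i, ∑ t, x.rate i t = if i ∈ x.selected then I.D i else 0

/-- The local peak caps are respected. -/
def RespectsLocalCaps (y : Fin n → Fin T → ℝ) : Prop := ∀ t j, I.load y t j ≤ I.C j

/-- The global peak cap is respected. -/
def RespectsGlobalCap (y : Fin n → Fin T → ℝ) : Prop := ∀ t, ∑ i, y i t ≤ I.Ctotal

/-- Feasible solutions of the (mixed integer) revenue maximization problem. -/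
structure IsFeasible (x : Schedule n T) : Prop where
  serves : I.ServesSelected x
  localCaps : I.RespectsLocalCaps x.rate
  globalCap : I.RespectsGlobalCap x.rate

/-- The revenue: the total value of the selected EVs. -/
def revenue (x : Schedule n T) : ℝ := ∑ i ∈ x.selected, I.v i

/-- Feasible solutions of the linear relaxation. -/
structure IsLPFeasible (y : Fin n → Fin T → ℝ) : Prop where
  nonneg : ∀ i t, 0 ≤ y i t
  deadline : ∀ i t, ¬ I.InWindow i t → y i t = 0
  total_le : ∀ i, ∑ t, y i t ≤ I.D i
  rate_le : ∀ i t, y i t - I.k i / I.D i * ∑ t', y i t' ≤ 0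
  localCaps : I.RespectsLocalCaps y
  globalCap : I.RespectsGlobalCap y

/-- Objective of the linear relaxation. -/
def lpValue (y : Fin n → Fin T → ℝ) : ℝ := ∑ i, I.v i / I.D i * ∑ t, y i t

/-! ### The SCS algorithm

The procedures take as a parameter the rule `avail x t j` for the load `W̄(t, j)` that is still
available at station `j` in slot `t` when the current schedule is `x`. The dual variables that the
algorithm records on the way are only written, never read by a step that changes the schedule or
the selection, so they are not part of the state. -/

/-- Availability `C j - W(t, j)`: what is left of the local cap. -/
def localAvail (x : Schedule n T) (t : Fin T) (j : Fin m) : ℝ :=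
  I.C j - I.load x.rate t j

/-- What is left of the local cap and of the global cap. -/
def globalAvail (x : Schedule n T) (t : Fin T) (j : Fin m) : ℝ :=
  min (I.C j - I.load x.rate t j) (I.Ctotal - ∑ i, x.rate i t)

/-- The slots up to the deadline of EV `i`, from the highest to the lowest rank: more available
load `w` first, and later slots first among those with equal available load. -/
def rankedSlots (w : Fin T → ℝ) (i : Fin n) : List (Fin T) :=
  ((List.finRange T).filter fun t => decide (I.InWindow i t)).mergeSort
    fun t₁ t₂ => decide (w t₂ < w t₁ ∨ (w t₁ = w t₂ ∧ t₂ ≤ t₁))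

/-- Go through the slots in the given order and allocate `min k (w t)` in slot `t`, until the
remaining demand `r` is fully allocated (the last allocation is cut off at `r`). -/
def fill (k : ℝ) (w : Fin T → ℝ) : List (Fin T) → ℝ → Fin T → ℝ
  | [], _ => fun _ => 0
  | t :: ts, r =>
    if 0 < r then
      Function.update (fill k w ts (r - min (min k (w t)) r)) t (min (min k (w t)) r)
    else fun _ => 0

/-- `SmartAllocate(i)`. -/
def smartAllocate (avail : Schedule n T → Fin T → Fin m → ℝ) (x : Schedule n T) (i : Fin n) :
    Schedule n T :=
  let w : Fin T → ℝ := fun t => avail x t (I.P i)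
  ⟨insert i x.selected,
    Function.update x.rate i (fill (I.k i) w (I.rankedSlots w i) (I.D i))⟩

/-- First phase, processing EV `i`: allocate if enough resources remain. -/
def greedyStep (avail : Schedule n T → Fin T → Fin m → ℝ) (x : Schedule n T) (i : Fin n) :
    Schedule n T :=
  if I.D i ≤ ∑ t with I.InWindow i t, min (avail x t (I.P i)) (I.k i) then
    I.smartAllocate avail x i
  else x

/-- State of the search in `ReConsider(i)`: the list `L`, the value `v_inc` and the amounts `δ_i`. -/
structure Search (n T : ℕ) where
  L : Finset (Fin n)
  vinc : ℝ
  δ : Fin T → ℝ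

/-- Inner loop of `ReConsider(i)`, for the candidate `i'`. -/
def searchStep (x : Schedule n T) (i : Fin n) (c : Search n T) (i' : Fin n) : Search n T :=
  if i' ∈ x.selected ∧ I.P i' = I.P i ∧ 0 < c.vinc - I.v i' then
    ⟨insert i' c.L, c.vinc - I.v i', fun t => min (I.k i) (c.δ t + x.rate i' t)⟩
  else c

/-- `ReConsider(i)`, where `prev` lists the EVs before `i` in the sorted order, last one first. -/
def reConsider (avail : Schedule n T → Fin T → Fin m → ℝ) (prev : List (Fin n))
    (x : Schedule n T) (i : Fin n) : Schedule n T :=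
  let c := prev.foldl (I.searchStep x i) ⟨∅, I.v i, fun t => min (I.k i) (avail x t (I.P i))⟩
  if I.D i ≤ ∑ t with I.InWindow i t, c.δ t then
    I.smartAllocate avail (x.remove c.L) i
  else x

/-- Second phase: call `ReConsider` on the unselected EVs in the sorted order. The first list holds
the EVs that have been passed already, last one first, the second one those still to come. -/
def secondPhase (avail : Schedule n T → Fin T → Fin m → ℝ) :
    List (Fin n) → List (Fin n) → Schedule n T → Schedule n T
  | _, [], x => x
  | prev, i :: rest, x =>
    secondPhase avail (i :: prev) rest
      (if i ∈ x.selected then x else I.reConsider avail prev x i)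

/-- The SCS algorithm, run on the EVs in the given order. -/
def scs (avail : Schedule n T → Fin T → Fin m → ℝ) (order : List (Fin n)) : Schedule n T :=
  I.secondPhase avail [] order (order.foldl (I.greedyStep avail) Schedule.empty)

/-- `order` lists all EVs by value/demand ratio, `v₁/D₁ ≥ v₂/D₂ ≥ …` (ties in any way). -/
structure IsSortedOrder (order : List (Fin n)) : Prop where
  nodup : order.Nodup
  complete : ∀ i, i ∈ order
  sorted : order.Pairwise fun i i' => I.v i' / I.D i' ≤ I.v i / I.D i

/-- The factor `1 + ∑ⱼ Cⱼ/(Cⱼ - Kⱼ) · s/(s-1)`. -/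
def ratio : ℝ := 1 + ∑ j, I.C j / (I.C j - I.K j) * (I.s / (I.s - 1))

end Instance

end EVCharging

end

open Finset

namespace EVCharging

/-! The approximation factor comes from the first phase alone; the second phase only has to keep the
constraints and not lower the revenue. Write κ = s/(s-1) and call v/D the density of an EV.

Suppose the first phase rejects EV i. Let c be the capacity of its station and V(t) the load of all
stations together in slot t. Every slot t up to the deadline still offers i at least k_i(1 -
V(t)/c). Summing over the d_i slots and comparing with D_i ≤ k_i d_i / s bounds c·d_i by κ times the
demand selected so far, and all EVs selected so far are at least as dense as i
(`volume_of_rejected`, `firstPhase`).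

Now take any solution of the linear relaxation. The selected EVs contribute at most their own value.
Among the unselected EVs of one station whose density exceeds a threshold, let i₀ have the latest
deadline. Together they receive at most c·d_{i₀}, hence at most κ times the demand of the selected
EVs above the same threshold. Such a volume comparison at every threshold gives the comparison of
density-weighted volumes, by summation over layers (`weighted_sum_nonneg_of_levels`). So each
station costs at most κ times the revenue (`lp_unselected_le`), and the factor is 1 + mκ ≤ ρ.

The two rules enter only through `IsAvailability`, with c = C_j for (L) and c = min{C_j, C_total}
for (G). -/

/-- If all sums of `f` over the upper level sets of a nonnegative weight are nonnegative, so is the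
weighted sum. -/
theorem weighted_sum_nonneg_of_levels {ι : Type*} (w f : ι → ℝ) (A : Finset ι)
    (hw : ∀ i ∈ A, 0 ≤ w i) (hf : ∀ a ∈ A, 0 ≤ ∑ i ∈ A with w a ≤ w i, f i) :
    0 ≤ ∑ i ∈ A, w i * f i := by
  -- Subtracting a base level b lets the induction peel off the lowest layer: the minimum weight is
  -- attained on all of `A`, and the excess over it lives on a strictly smaller upper level set.
  suffices h : ∀ (N : ℕ) (A : Finset ι) (b : ℝ), #A = N → 0 ≤ b → (∀ i ∈ A, b ≤ w i) →
      (∀ a ∈ A, 0 ≤ ∑ i ∈ A with w a ≤ w i, f i) → 0 ≤ ∑ i ∈ A, (w i - b) * f i by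
    simpa using h _ A 0 rfl le_rfl hw hf
  intro N
  induction N using Nat.strong_induction_on with
  | _ N ih =>
    intro A b hN hb hw hf
    rcases A.eq_empty_or_nonempty with rfl | hA
    · simp
    obtain ⟨a, ha, hmin⟩ := A.exists_min_image w hA
    have hall : 0 ≤ ∑ i ∈ A, f i := by
      have := hf a ha
      rwa [Finset.filter_true_of_mem hmin] at this
    have hlt : #(A.filter fun i => w a < w i) < N := by
      rw [← hN]
      exact card_lt_card (filter_ssubset.2 ⟨a, ha, lt_irrefl _⟩)
    have hrec := ih _ hlt (A.filter fun i => w a < w i) (w a) rfl (hb.trans (hw a ha))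
      (fun i hi => (mem_filter.1 hi).2.le) (by
        intro i hi
        have hi' := mem_filter.1 hi
        convert hf i hi'.1 using 2
        ext x
        simp only [mem_filter]
        exact ⟨fun h => ⟨h.1.1, h.2⟩, fun h => ⟨⟨h.1, hi'.2.trans_le h.2⟩, h.2⟩⟩)
    have hsplit : ∑ i ∈ A, (w i - b) * f i =
        (w a - b) * ∑ i ∈ A, f i + ∑ i ∈ A with w a < w i, (w i - w a) * f i := by
      rw [Finset.sum_filter, Finset.mul_sum, ← Finset.sum_add_distrib]
      refine Finset.sum_congr rfl fun i hi => ?_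
      split_ifs with h
      · ring
      · rw [le_antisymm (not_lt.1 h) (hmin i hi)]
        ring
    rw [hsplit]
    exact add_nonneg (mul_nonneg (sub_nonneg.2 (hw a ha)) hall) hrec

namespace Instance

variable {n m T : ℕ} (I : Instance n m T)

/-! ### Allocation of a single EV -/

/-- Nothing here depends on the order of the slots, so the ranking in `SmartAllocate` plays no role
in the analysis. -/
theorem fill_spec {k : ℝ} (hk : 0 ≤ k) {w : Fin T → ℝ} (hw : ∀ t, 0 ≤ w t) (l : List (Fin T))
    (hl : l.Nodup) (r : ℝ) (hr : 0 ≤ r) :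
    (∀ t, 0 ≤ fill k w l r t) ∧ (∀ t, fill k w l r t ≤ min k (w t)) ∧
      (∀ t, t ∉ l → fill k w l r t = 0) ∧
      (r ≤ (l.map fun t => min k (w t)).sum → ∑ t, fill k w l r t = r) := by
  induction l generalizing r with
  | nil =>
    refine ⟨fun t => le_rfl, fun t => le_min hk (hw t), fun t _ => rfl, fun h => ?_⟩
    simp only [List.map_nil, List.sum_nil] at h
    simp [fill, le_antisymm h hr]
  | cons a l ih =>
    obtain ⟨ha, hl⟩ := List.nodup_cons.1 hl
    by_cases h : 0 < r
    · have hfill : fill k w (a :: l) r = Function.update (fill k w l (r - min (min k (w a)) r)) a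
        (min (min k (w a)) r) := by simp [fill, h]
      obtain ⟨h1, h2, h3, h4⟩ := ih hl (r - min (min k (w a)) r) (sub_nonneg.2 (min_le_right _ _))
      rw [hfill]
      refine ⟨fun t => ?_, fun t => ?_, fun t ht => ?_, fun hsum => ?_⟩
      · rcases eq_or_ne t a with rfl | hta
        · simpa using ⟨⟨hk, hw t⟩, hr⟩
        · simpa [hta] using h1 t
      · rcases eq_or_ne t a with rfl | hta
        · simp only [Function.update_self]
          exact min_le_left _ _
        · simpa only [Function.update_of_ne hta] using h2 t
      · simp only [List.mem_cons, not_or] at ht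
        rw [Function.update_of_ne ht.1]
        exact h3 t ht.2
      · rw [Finset.sum_update_of_mem (mem_univ a), ← Finset.erase_eq,
          Finset.sum_erase _ (h3 a ha), h4]
        · ring
        · simp only [List.map_cons, List.sum_cons] at hsum
          rcases le_total (min k (w a)) r with h' | h'
          · rw [min_eq_left h']
            linarith
          · rw [min_eq_right h', sub_self]
            refine List.sum_nonneg fun z hz => ?_
            obtain ⟨t, -, rfl⟩ := List.mem_map.1 hz
            exact le_min hk (hw t)
    · have hr0 : r = 0 := le_antisymm (not_lt.1 h) hr
      have hfill : fill k w (a :: l) r = fun _ => 0 := by simp [fill, h]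
      rw [hfill]
      exact ⟨fun t => le_rfl, fun t => le_min hk (hw t), fun t _ => rfl, fun _ => by simp [hr0]⟩

theorem rankedSlots_perm (w : Fin T → ℝ) (i : Fin n) :
    (I.rankedSlots w i).Perm ((List.finRange T).filter fun t => decide (I.InWindow i t)) :=
  List.mergeSort_perm _ _

theorem rankedSlots_nodup (w : Fin T → ℝ) (i : Fin n) : (I.rankedSlots w i).Nodup :=
  (I.rankedSlots_perm w i).nodup_iff.2 ((List.nodup_finRange T).filter _)

theorem mem_rankedSlots (w : Fin T → ℝ) (i : Fin n) (t : Fin T) :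
    t ∈ I.rankedSlots w i ↔ I.InWindow i t := by
  rw [(I.rankedSlots_perm w i).mem_iff]
  simp

theorem sum_rankedSlots (w : Fin T → ℝ) (i : Fin n) (g : Fin T → ℝ) :
    ((I.rankedSlots w i).map g).sum = ∑ t with I.InWindow i t, g t := by
  rw [← List.sum_toFinset _ (I.rankedSlots_nodup w i)]
  refine Finset.sum_congr ?_ fun _ _ => rfl
  ext t
  simp [mem_rankedSlots]

/-- The slots are numbered from 0, so the window is t < d_i; as d_i ≤ T, none of its d_i slots is
missing. -/
theorem card_window (i : Fin n) : #{t : Fin T | I.InWindow i t} = I.d i := by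
  have h : (univ.filter fun t : Fin T => I.InWindow i t).map Fin.valEmbedding =
      Finset.range (I.d i) := by
    ext t
    simp only [mem_map, mem_filter, mem_univ, true_and, Fin.valEmbedding_apply, mem_range]
    refine ⟨?_, fun ht => ⟨⟨t, ht.trans_le (I.d_le i)⟩, ht, rfl⟩⟩
    rintro ⟨a, ha, rfl⟩
    exact ha
  rw [← card_map, h, card_range]

/-! ### Rules for the available load -/

/-- What the analysis needs to know about a rule `avail` for the available load: it keeps the
schedules within the constraints `Good`, and it blocks a slot at station `j` only in proportion to
the part of the capacity `c j` that is in use. -/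
structure IsAvailability (avail : Schedule n T → Fin T → Fin m → ℝ)
    (Good : (Fin n → Fin T → ℝ) → Prop) (c : Fin m → ℝ) : Prop where
  zero : Good fun _ _ => 0
  nonneg : ∀ x : Schedule n T, Good x.rate → ∀ t j, 0 ≤ avail x t j
  mono : ∀ y y' : Fin n → Fin T → ℝ, Good y → (∀ i t, y' i t ≤ y i t) → Good y'
  update : ∀ (x : Schedule n T) (i : Fin n) (f : Fin T → ℝ), Good x.rate →
    (∀ t, x.rate i t = 0) → (∀ t, f t ≤ avail x t (I.P i)) → Good (Function.update x.rate i f)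
  remove : ∀ (x : Schedule n T) (L : Finset (Fin n)) (t : Fin T) (j : Fin m),
    (∀ i ∈ L, I.P i = j) → avail (x.remove L) t j = avail x t j + ∑ i ∈ L, x.rate i t
  cap_pos : ∀ j, 0 < c j
  blocking : ∀ (x : Schedule n T) (i : Fin n) (t : Fin T), Good x.rate →
    (∀ i t, 0 ≤ x.rate i t) →
    I.k i * (1 - (∑ i', x.rate i' t) / c (I.P i)) ≤ min (avail x t (I.P i)) (I.k i)

variable {I} {avail : Schedule n T → Fin T → Fin m → ℝ} {Good : (Fin n → Fin T → ℝ) → Prop}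
  {c : Fin m → ℝ}

theorem servesSelected_empty : I.ServesSelected Schedule.empty :=
  ⟨fun _ _ => le_rfl, fun _ _ _ => rfl, fun i _ => (I.k_pos i).le, fun i => by
    simp [Schedule.empty]⟩

theorem ServesSelected.rate_eq_zero {x : Schedule n T} (hx : I.ServesSelected x) {i : Fin n}
    (hi : i ∉ x.selected) (t : Fin T) : x.rate i t = 0 := by
  have h := hx.total i
  rw [if_neg hi, Finset.sum_eq_zero_iff_of_nonneg fun t _ => hx.nonneg i t] at h
  exact h t (mem_univ t)

theorem ServesSelected.remove {x : Schedule n T} (hx : I.ServesSelected x) (L : Finset (Fin n)) :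
    I.ServesSelected (x.remove L) := by
  refine ⟨fun i t => ?_, fun i t ht => ?_, fun i t => ?_, fun i => ?_⟩ <;>
    by_cases hi : i ∈ L <;> simp only [Schedule.remove, hi, if_true, if_false, mem_sdiff]
  · exact le_rfl
  · exact hx.nonneg i t
  · exact hx.deadline i t ht
  · exact (I.k_pos i).le
  · exact hx.rate_le i t
  · simp
  · simpa using hx.total i

theorem IsAvailability.good_remove (hav : I.IsAvailability avail Good c) {x : Schedule n T}
    (hx : I.ServesSelected x) (hg : Good x.rate) (L : Finset (Fin n)) :
    Good (x.remove L).rate := by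
  refine hav.mono _ _ hg fun i t => ?_
  simp only [Schedule.remove]
  split_ifs
  · exact hx.nonneg i t
  · exact le_rfl

/-- A successful call of `SmartAllocate`. -/
theorem IsAvailability.smartAllocate (hav : I.IsAvailability avail Good c) {x : Schedule n T}
    (hx : I.ServesSelected x) (hg : Good x.rate) {i : Fin n} (hi : i ∉ x.selected)
    (hD : I.D i ≤ ∑ t with I.InWindow i t, min (I.k i) (avail x t (I.P i))) :
    I.ServesSelected (I.smartAllocate avail x i) ∧ Good (I.smartAllocate avail x i).rate := by
  set w : Fin T → ℝ := fun t => avail x t (I.P i) with hw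
  obtain ⟨h1, h2, h3, h4⟩ := fill_spec (I.k_pos i).le (w := w) (fun t => hav.nonneg x hg t _)
    (I.rankedSlots w i) (I.rankedSlots_nodup w i) (I.D i) (I.D_pos i).le
  have h5 := h4 (by rw [sum_rankedSlots]; exact hD)
  refine ⟨⟨fun i' t => ?_, fun i' t ht => ?_, fun i' t => ?_, fun i' => ?_⟩, ?_⟩
  on_goal 5 =>
    exact hav.update x i _ hg (hx.rate_eq_zero hi) fun t => (h2 t).trans (min_le_right _ _)
  all_goals
    rcases eq_or_ne i' i with rfl | hne
    · simp only [Instance.smartAllocate, Function.update_self, mem_insert_self, if_true]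
      first
        | exact h1 t
        | exact h3 t (by rwa [mem_rankedSlots])
        | exact (h2 t).trans (min_le_left _ _)
        | exact h5
    · simp only [Instance.smartAllocate, Function.update_of_ne hne, mem_insert, hne, false_or]
      first
        | exact hx.nonneg i' t
        | exact hx.deadline i' t ht
        | exact hx.rate_le i' t
        | exact hx.total i'

/-! ### The first phase -/

/-- If EV `i` does not fit, then the demand of the selected EVs is comparable to the whole capacity
up to the deadline of `i`. -/
theorem IsAvailability.volume_of_rejected (hav : I.IsAvailability avail Good c) (hs : 1 < I.s)
    {x : Schedule n T} (hx : I.ServesSelected x) (hg : Good x.rate) {i : Fin n}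
    (hD : ¬ I.D i ≤ ∑ t with I.InWindow i t, min (avail x t (I.P i)) (I.k i)) :
    c (I.P i) * I.d i ≤ I.s / (I.s - 1) * ∑ i' ∈ x.selected, I.D i' := by
  have hc := hav.cap_pos (I.P i)
  have hk := I.k_pos i
  have hle : ∑ t with I.InWindow i t, ∑ i', x.rate i' t ≤ ∑ i' ∈ x.selected, I.D i' := by
    calc ∑ t with I.InWindow i t, ∑ i', x.rate i' t ≤ ∑ t, ∑ i', x.rate i' t :=
          Finset.sum_le_sum_of_subset_of_nonneg (filter_subset _ _)
            fun t _ _ => Finset.sum_nonneg fun i' _ => hx.nonneg i' t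
      _ = ∑ i', ∑ t, x.rate i' t := Finset.sum_comm
      _ = ∑ i' ∈ x.selected, I.D i' := by simp [hx.total]
  have hblock : ∑ t with I.InWindow i t, I.k i * (1 - (∑ i', x.rate i' t) / c (I.P i)) ≤
      ∑ t with I.InWindow i t, min (avail x t (I.P i)) (I.k i) :=
    Finset.sum_le_sum fun t _ => hav.blocking x i t hg hx.nonneg
  rw [← Finset.mul_sum, Finset.sum_sub_distrib, ← Finset.sum_div, Finset.sum_const, card_window,
    nsmul_eq_mul, mul_one] at hblock
  have hlt := (hblock.trans_lt (not_le.1 hD)).trans_le (I.slack i)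
  rw [mul_div_assoc] at hlt
  -- Both sides are proportional to the rate k_i, which cancels.
  have hlt' := lt_of_mul_lt_mul_left hlt hk.le
  have h1 : (I.d i : ℝ) - I.d i / I.s < (∑ i' ∈ x.selected, I.D i') / c (I.P i) := by
    have := div_le_div_of_nonneg_right hle hc.le
    linarith
  rw [lt_div_iff₀ hc] at h1
  have hs1 : 0 < I.s - 1 := sub_pos.2 hs
  have hs0 : 0 < I.s := by linarith
  rw [div_mul_eq_mul_div, le_div_iff₀ hs1]
  have h2 : ((I.d i : ℝ) - I.d i / I.s) * c (I.P i) * I.s = c (I.P i) * I.d i * (I.s - 1) := by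
    field_simp
  rw [← h2, mul_comm I.s]
  exact (mul_lt_mul_of_pos_right h1 hs0).le

/-- The result of the first phase: it is admissible, and the selected EVs that are at least as
dense in value as a given unselected EV `i` have a demand comparable to the whole capacity up to the
deadline of `i`. -/
theorem IsAvailability.firstPhase (hav : I.IsAvailability avail Good c) (hs : 1 < I.s)
    (l : List (Fin n)) (x : Schedule n T) (hx : I.ServesSelected x) (hg : Good x.rate)
    (hl : l.Nodup) (hsort : l.Pairwise fun i i' => I.v i' / I.D i' ≤ I.v i / I.D i)
    (hdisj : ∀ i ∈ l, i ∉ x.selected)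
    (hprev : ∀ i' ∈ x.selected, ∀ i ∈ l, I.v i / I.D i ≤ I.v i' / I.D i') :
    I.ServesSelected (l.foldl (I.greedyStep avail) x) ∧
      Good (l.foldl (I.greedyStep avail) x).rate ∧
      x.selected ⊆ (l.foldl (I.greedyStep avail) x).selected ∧
      ∀ i ∈ l, i ∉ (l.foldl (I.greedyStep avail) x).selected →
        c (I.P i) * I.d i ≤ I.s / (I.s - 1) *
          ∑ i' ∈ (l.foldl (I.greedyStep avail) x).selected with I.v i / I.D i ≤ I.v i' / I.D i',
            I.D i' := by
  induction l generalizing x with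
  | nil => exact ⟨hx, hg, Subset.rfl, by simp⟩
  | cons a l ih =>
    obtain ⟨hal, hl⟩ := List.nodup_cons.1 hl
    obtain ⟨hsa, hsort⟩ := List.pairwise_cons.1 hsort
    rw [List.foldl_cons]
    by_cases h : I.D a ≤ ∑ t with I.InWindow a t, min (avail x t (I.P a)) (I.k a)
    · rw [show I.greedyStep avail x a = I.smartAllocate avail x a from if_pos h]
      obtain ⟨hx', hg'⟩ := hav.smartAllocate hx hg (hdisj a List.mem_cons_self)
        (by simpa only [min_comm] using h)
      obtain ⟨h1, h2, h3, h4⟩ := ih _ hx' hg' hl hsort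
        (by
          intro i hi
          simp only [Instance.smartAllocate, mem_insert, not_or]
          exact ⟨fun h => hal (h ▸ hi), hdisj i (List.mem_cons_of_mem _ hi)⟩)
        (by
          intro i' hi' i hi
          rcases mem_insert.1 hi' with rfl | hi'
          · exact hsa i hi
          · exact hprev i' hi' i (List.mem_cons_of_mem _ hi))
      refine ⟨h1, h2, (subset_insert a x.selected).trans h3, fun i hi hni => ?_⟩
      rcases List.mem_cons.1 hi with rfl | hi
      · exact absurd (h3 (mem_insert_self _ _)) hni
      · exact h4 i hi hni
    · rw [show I.greedyStep avail x a = x from if_neg h]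
      obtain ⟨h1, h2, h3, h4⟩ := ih x hx hg hl hsort
        (fun i hi => hdisj i (List.mem_cons_of_mem _ hi))
        (fun i' hi' i hi => hprev i' hi' i (List.mem_cons_of_mem _ hi))
      refine ⟨h1, h2, h3, fun i hi hni => ?_⟩
      rcases List.mem_cons.1 hi with rfl | hi
      · refine (hav.volume_of_rejected hs hx hg h).trans ?_
        refine mul_le_mul_of_nonneg_left ?_ (div_nonneg (by linarith) (by linarith))
        -- The EVs selected when `i` is rejected precede it in the order, hence are at least as
        -- dense, and the first phase never unselects them.
        refine Finset.sum_le_sum_of_subset_of_nonneg (fun i' hi' => ?_) fun i' _ _ => (I.D_pos i').le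
        exact mem_filter.2 ⟨h3 hi', hprev i' hi' _ List.mem_cons_self⟩
      · exact h4 i hi hni

/-! ### The second phase -/

/-- The outcome of the search in `ReConsider`. -/
theorem search_spec {x : Schedule n T} (hx : I.ServesSelected x) (i : Fin n) (w : Fin T → ℝ)
    (prev : List (Fin n)) (hprev : prev.Nodup) (s : Search n T)
    (hdisj : ∀ i' ∈ prev, i' ∉ s.L) (hL : ∀ i' ∈ s.L, i' ∈ x.selected ∧ I.P i' = I.P i)
    (hv : s.vinc = I.v i - ∑ i' ∈ s.L, I.v i') (hv0 : 0 ≤ s.vinc)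
    (hδ : ∀ t, s.δ t = min (I.k i) (w t + ∑ i' ∈ s.L, x.rate i' t)) :
    (∀ i' ∈ (prev.foldl (I.searchStep x i) s).L, i' ∈ x.selected ∧ I.P i' = I.P i) ∧
      ∑ i' ∈ (prev.foldl (I.searchStep x i) s).L, I.v i' ≤ I.v i ∧
      ∀ t, (prev.foldl (I.searchStep x i) s).δ t =
        min (I.k i) (w t + ∑ i' ∈ (prev.foldl (I.searchStep x i) s).L, x.rate i' t) := by
  induction prev generalizing s with
  | nil => exact ⟨hL, by rw [List.foldl_nil]; linarith, hδ⟩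
  | cons a prev ih =>
    obtain ⟨ha, hprev⟩ := List.nodup_cons.1 hprev
    rw [List.foldl_cons]
    have haL := hdisj a List.mem_cons_self
    by_cases h : a ∈ x.selected ∧ I.P a = I.P i ∧ 0 < s.vinc - I.v a
    · rw [show I.searchStep x i s a = ⟨insert a s.L, s.vinc - I.v a,
        fun t => min (I.k i) (s.δ t + x.rate a t)⟩ from if_pos h]
      refine ih hprev _ ?_ ?_ ?_ h.2.2.le ?_
      · intro i' hi'
        simp only [mem_insert, not_or]
        exact ⟨fun h => ha (h ▸ hi'), hdisj i' (List.mem_cons_of_mem _ hi')⟩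
      · intro i' hi'
        rcases mem_insert.1 hi' with rfl | hi'
        · exact ⟨h.1, h.2.1⟩
        · exact hL i' hi'
      · simp only [Finset.sum_insert haL, hv]
        ring
      · intro t
        have hr := hx.nonneg a t
        simp only [Finset.sum_insert haL, hδ, ← min_add_add_right, ← min_assoc]
        -- Rates are nonnegative, so truncating at k_i after every addition amounts to truncating
        -- once at the end.
        rw [min_eq_left (by linarith : I.k i ≤ I.k i + x.rate a t)]
        congr 1
        ring
    · rw [show I.searchStep x i s a = s from if_neg h]
      exact ih hprev s (fun i' hi' => hdisj i' (List.mem_cons_of_mem _ hi')) hL hv hv0 hδ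

/-- The removed EVs are together worth at most v_i, so exchanging them for `i` loses no revenue. -/
theorem IsAvailability.reConsider (hav : I.IsAvailability avail Good c) {prev : List (Fin n)}
    (hprev : prev.Nodup) {x : Schedule n T} (hx : I.ServesSelected x) (hg : Good x.rate)
    {i : Fin n} (hi : i ∉ x.selected) :
    I.ServesSelected (I.reConsider avail prev x i) ∧ Good (I.reConsider avail prev x i).rate ∧
      I.revenue x ≤ I.revenue (I.reConsider avail prev x i) := by
  obtain ⟨hL, hv, hδ⟩ := search_spec hx i (fun t => avail x t (I.P i)) prev hprev
    ⟨∅, I.v i, fun t => min (I.k i) (avail x t (I.P i))⟩ (by simp) (by simp) (by simp)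
    (I.v_nonneg i) (by simp)
  set s := prev.foldl (I.searchStep x i) ⟨∅, I.v i, fun t => min (I.k i) (avail x t (I.P i))⟩
    with hsdef
  by_cases h : I.D i ≤ ∑ t with I.InWindow i t, s.δ t
  · rw [show I.reConsider avail prev x i = I.smartAllocate avail (x.remove s.L) i from if_pos h]
    have hi' : i ∉ (x.remove s.L).selected := fun h => hi (mem_sdiff.1 h).1
    -- Since all of `L` sits at the station of `i`, δ(t) is exactly min(k_i, availability after
    -- removing `L`): the test of `ReConsider` is the one `SmartAllocate` needs.
    obtain ⟨h1, h2⟩ := hav.smartAllocate (hx.remove s.L) (hav.good_remove hx hg s.L) hi' (by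
      refine h.trans_eq (Finset.sum_congr rfl fun t _ => ?_)
      rw [hδ, hav.remove x s.L t _ fun i' hi' => (hL i' hi').2])
    refine ⟨h1, h2, ?_⟩
    have hsub : s.L ⊆ x.selected := fun i' hi' => (hL i' hi').1
    have := Finset.sum_sdiff (f := I.v) hsub
    have hins := Finset.sum_insert (f := I.v) hi'
    simp only [Schedule.remove] at hins
    simp only [revenue, Instance.smartAllocate, Schedule.remove]
    linarith
  · rw [show I.reConsider avail prev x i = x from if_neg h]
    exact ⟨hx, hg, le_rfl⟩

theorem IsAvailability.secondPhase (hav : I.IsAvailability avail Good c) (rest : List (Fin n))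
    (prev : List (Fin n)) (hnodup : (prev ++ rest).Nodup) (x : Schedule n T)
    (hx : I.ServesSelected x) (hg : Good x.rate) :
    I.ServesSelected (I.secondPhase avail prev rest x) ∧
      Good (I.secondPhase avail prev rest x).rate ∧
      I.revenue x ≤ I.revenue (I.secondPhase avail prev rest x) := by
  induction rest generalizing prev x with
  | nil => exact ⟨hx, hg, le_rfl⟩
  | cons a rest ih =>
    rw [Instance.secondPhase]
    have hnodup' : (a :: prev ++ rest).Nodup := List.perm_middle.nodup_iff.1 hnodup
    split_ifs with ha
    · exact ih _ hnodup' x hx hg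
    · obtain ⟨h1, h2, h3⟩ := hav.reConsider (List.nodup_append.1 hnodup).1 hx hg ha
      obtain ⟨h4, h5, h6⟩ := ih _ hnodup' _ h1 h2
      exact ⟨h4, h5, h3.trans h6⟩

/-! ### Comparison with the linear relaxation -/

theorem revenue_nonneg (x : Schedule n T) : 0 ≤ I.revenue x :=
  Finset.sum_nonneg fun i _ => I.v_nonneg i

theorem density_nonneg (i : Fin n) : 0 ≤ I.v i / I.D i :=
  div_nonneg (I.v_nonneg i) (I.D_pos i).le

/-- A set of EVs at one station whose deadlines are at most that of `i₀` cannot receive more than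
the capacity of the station up to that deadline. -/
theorem lp_volume_le {y : Fin n → Fin T → ℝ} (hy : I.IsLPFeasible y) {j : Fin m} {cj : ℝ}
    (hload : ∀ t, I.load y t j ≤ cj) {V : Finset (Fin n)} (hV : ∀ i ∈ V, I.P i = j) {i₀ : Fin n}
    (hd : ∀ i ∈ V, I.d i ≤ I.d i₀) : ∑ i ∈ V, ∑ t, y i t ≤ cj * I.d i₀ := by
  calc ∑ i ∈ V, ∑ t, y i t = ∑ i ∈ V, ∑ t with I.InWindow i₀ t, y i t := by
        refine Finset.sum_congr rfl fun i hi => ?_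
        refine (Finset.sum_subset (filter_subset _ _) fun t _ ht => hy.deadline i t fun hw => ?_).symm
        exact ht (mem_filter.2 ⟨mem_univ t, le_trans hw (hd i hi)⟩)
    _ = ∑ t with I.InWindow i₀ t, ∑ i ∈ V, y i t := Finset.sum_comm
    _ ≤ ∑ t with I.InWindow i₀ t, cj := by
        refine Finset.sum_le_sum fun t _ => le_trans ?_ (hload t)
        exact Finset.sum_le_sum_of_subset_of_nonneg
          (fun i hi => mem_filter.2 ⟨mem_univ i, hV i hi⟩) fun i _ _ => hy.nonneg i t
    _ = cj * I.d i₀ := by rw [Finset.sum_const, card_window, nsmul_eq_mul, mul_comm]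

/-- The unselected EVs at one station contribute at most `κ` times the revenue. -/
theorem lp_unselected_le {y : Fin n → Fin T → ℝ} (hy : I.IsLPFeasible y) (x : Schedule n T)
    {j : Fin m} {cj κ : ℝ} (hκ : 0 ≤ κ) (hload : ∀ t, I.load y t j ≤ cj)
    (hvol : ∀ i, i ∉ x.selected → I.P i = j → cj * I.d i ≤
      κ * ∑ i' ∈ x.selected with I.v i / I.D i ≤ I.v i' / I.D i', I.D i') :
    ∑ i with i ∉ x.selected ∧ I.P i = j, I.v i / I.D i * ∑ t, y i t ≤ κ * I.revenue x := by
  -- Writing v_i as density times D_i turns both sides into sums with the same weights, ready for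
  -- the level-set lemma.
  have hrev : κ * I.revenue x =
      ∑ i, I.v i / I.D i * (if i ∈ x.selected then κ * I.D i else 0) := by
    simp only [mul_ite, mul_zero, Finset.sum_ite_mem, univ_inter, revenue, Finset.mul_sum]
    refine Finset.sum_congr rfl fun i _ => ?_
    have := (I.D_pos i).ne'
    field_simp
  rw [hrev, Finset.sum_filter, ← sub_nonneg, ← Finset.sum_sub_distrib]
  have key := weighted_sum_nonneg_of_levels (fun i => I.v i / I.D i)
    (fun i => (if i ∈ x.selected then κ * I.D i else 0) -
      if i ∉ x.selected ∧ I.P i = j then ∑ t, y i t else 0) univ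
    (fun i _ => density_nonneg i) (by
      intro a _
      set V : Finset (Fin n) := {i | (I.v a / I.D a ≤ I.v i / I.D i) ∧
        (i ∉ x.selected ∧ I.P i = j)} with hVdef
      have hV : ∀ i ∈ V, I.v a / I.D a ≤ I.v i / I.D i ∧ i ∉ x.selected ∧ I.P i = j :=
        fun i hi => (mem_filter.1 hi).2
      rw [Finset.sum_sub_distrib, sub_nonneg, ← Finset.sum_filter, ← Finset.sum_filter,
        filter_filter, filter_filter, ← hVdef, ← Finset.mul_sum]
      rcases V.eq_empty_or_nonempty with hVe | hVne
      · rw [hVe, sum_empty]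
        exact mul_nonneg hκ (Finset.sum_nonneg fun i _ => (I.D_pos i).le)
      -- The EV with the latest deadline bounds the volume of all of `V`, and its own rejection pays
      -- for that volume.
      · obtain ⟨i₀, hi₀, hmax⟩ := V.exists_max_image I.d hVne
        obtain ⟨hρ, hns, hP⟩ := hV i₀ hi₀
        refine (lp_volume_le hy hload (fun i hi => (hV i hi).2.2) hmax).trans
          ((hvol i₀ hns hP).trans (mul_le_mul_of_nonneg_left ?_ hκ))
        refine Finset.sum_le_sum_of_subset_of_nonneg (fun i hi => ?_) fun i _ _ => (I.D_pos i).le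
        obtain ⟨h1, h2⟩ := mem_filter.1 hi
        exact mem_filter.2 ⟨mem_univ i, hρ.trans h2, h1⟩)
  refine key.trans_eq (Finset.sum_congr rfl fun i _ => ?_)
  rw [mul_sub, mul_ite _ _ (∑ t, y i t), mul_zero]

/-- Each station charges its unselected EVs to the whole revenue, not just to its own share; this is
where the factor m arises. -/
theorem lpValue_le {y : Fin n → Fin T → ℝ} (hy : I.IsLPFeasible y) (x : Schedule n T)
    {κ : ℝ} (hκ : 0 ≤ κ) (hload : ∀ t j, I.load y t j ≤ c j)
    (hvol : ∀ i, i ∉ x.selected → c (I.P i) * I.d i ≤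
      κ * ∑ i' ∈ x.selected with I.v i / I.D i ≤ I.v i' / I.D i', I.D i') :
    I.lpValue y ≤ (1 + m * κ) * I.revenue x := by
  have hsel : ∑ i with i ∈ x.selected, I.v i / I.D i * ∑ t, y i t ≤ I.revenue x := by
    rw [filter_mem_eq_inter, univ_inter]
    refine Finset.sum_le_sum fun i _ => ?_
    refine (mul_le_mul_of_nonneg_left (hy.total_le i) (density_nonneg i)).trans_eq ?_
    exact div_mul_cancel₀ _ (I.D_pos i).ne'
  have hunsel : ∑ i with i ∉ x.selected, I.v i / I.D i * ∑ t, y i t ≤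
      m * (κ * I.revenue x) := by
    rw [← Finset.sum_fiberwise _ I.P]
    simp only [filter_filter]
    refine (Finset.sum_le_sum fun j _ => lp_unselected_le hy x hκ (fun t => hload t j)
      fun i hi hP => ?_).trans_eq (by simp)
    rw [← hP]
    exact hvol i hi
  rw [lpValue, ← Finset.sum_filter_add_sum_filter_not _ (fun i => i ∈ x.selected)]
  linarith

theorem k_le_K (i : Fin n) : I.k i ≤ I.K (I.P i) :=
  le_ciSup (f := fun i' : {i' : Fin n // I.P i' = I.P i} => I.k i')
    (Set.finite_range _).bddAbove ⟨i, rfl⟩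

theorem K_nonneg (j : Fin m) : 0 ≤ I.K j :=
  Real.iSup_nonneg fun i => (I.k_pos i).le

/-- The analysis yields 1 + mκ, which is at most ρ because K_j ≥ 0 makes each C_j/(C_j - K_j) at
least 1. -/
theorem one_add_le_ratio (hs : 1 < I.s) (hK : ∀ j, I.K j < I.C j) :
    1 + m * (I.s / (I.s - 1)) ≤ I.ratio := by
  have hκ : 0 ≤ I.s / (I.s - 1) := div_nonneg (by linarith) (by linarith)
  have : ∑ _j : Fin m, I.s / (I.s - 1) ≤
      ∑ j, I.C j / (I.C j - I.K j) * (I.s / (I.s - 1)) := by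
    refine Finset.sum_le_sum fun j _ => le_mul_of_one_le_left hκ ?_
    rw [one_le_div (sub_pos.2 (hK j))]
    linarith [I.K_nonneg j]
  simp only [sum_const, card_univ, Fintype.card_fin, nsmul_eq_mul] at this
  simpa [ratio] using this

theorem IsFeasible.isLPFeasible {x : Schedule n T} (hx : I.IsFeasible x) :
    I.IsLPFeasible x.rate := by
  refine ⟨hx.serves.nonneg, hx.serves.deadline, fun i => ?_, fun i t => ?_, hx.localCaps,
    hx.globalCap⟩
  · rw [hx.serves.total i]
    split_ifs
    · exact le_rfl
    · exact (I.D_pos i).le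
  · by_cases hi : i ∈ x.selected
    · rw [hx.serves.total i, if_pos hi, div_mul_cancel₀ _ (I.D_pos i).ne', sub_nonpos]
      exact hx.serves.rate_le i t
    · simp [hx.serves.rate_eq_zero hi]

theorem IsFeasible.lpValue_eq {x : Schedule n T} (hx : I.IsFeasible x) :
    I.lpValue x.rate = I.revenue x := by
  simp only [lpValue, hx.serves.total, mul_ite, mul_zero, Finset.sum_ite_mem, univ_inter, revenue]
  exact Finset.sum_congr rfl fun i _ => div_mul_cancel₀ _ (I.D_pos i).ne'

/-- The guarantee of SCS for any rule for the available load. -/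
theorem IsAvailability.scs (hav : I.IsAvailability avail Good c) (hs : 1 < I.s)
    (hK : ∀ j, I.K j < I.C j) (hload : ∀ y, I.IsLPFeasible y → ∀ t j, I.load y t j ≤ c j)
    {order : List (Fin n)} (horder : I.IsSortedOrder order) :
    I.ServesSelected (I.scs avail order) ∧ Good (I.scs avail order).rate ∧
      (∀ x, I.IsFeasible x → I.revenue x ≤ I.ratio * I.revenue (I.scs avail order)) ∧
      (∀ y, I.IsLPFeasible y → I.lpValue y ≤ I.ratio * I.revenue (I.scs avail order)) := by
  have hκ : 0 ≤ I.s / (I.s - 1) := div_nonneg (by linarith) (by linarith)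
  obtain ⟨h1, h2, -, h4⟩ := hav.firstPhase hs order Schedule.empty servesSelected_empty hav.zero
    horder.nodup horder.sorted (by simp [Schedule.empty]) (by simp [Schedule.empty])
  obtain ⟨h5, h6, h7⟩ := hav.secondPhase order [] horder.nodup _ h1 h2
  have hlp : ∀ y, I.IsLPFeasible y → I.lpValue y ≤ I.ratio * I.revenue (I.scs avail order) := by
    intro y hy
    refine (lpValue_le hy _ hκ (hload y hy)
      fun i hi => h4 i (horder.complete i) hi).trans ?_
    have h1 := one_add_le_ratio hs hK
    exact mul_le_mul h1 h7 (revenue_nonneg _) (le_trans (by positivity) h1)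
  exact ⟨h5, h6, fun x hx => hx.lpValue_eq ▸ hlp _ hx.isLPFeasible, hlp⟩

/-! ### The two rules -/

theorem load_mono {y y' : Fin n → Fin T → ℝ} (h : ∀ i t, y' i t ≤ y i t) (t : Fin T) (j : Fin m) :
    I.load y' t j ≤ I.load y t j :=
  Finset.sum_le_sum fun i _ => h i t

theorem sum_update_row {y : Fin n → Fin T → ℝ} {i : Fin n} {t : Fin T} (hi : y i t = 0)
    (f : Fin T → ℝ) {A : Finset (Fin n)} (hA : i ∈ A) :
    ∑ i' ∈ A, Function.update y i f i' t = ∑ i' ∈ A, y i' t + f t := by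
  rw [← Finset.add_sum_erase _ _ hA, ← Finset.add_sum_erase _ _ hA, hi, Function.update_self]
  rw [Finset.sum_congr rfl fun i' hi' => by rw [Function.update_of_ne (ne_of_mem_erase hi')]]
  ring

theorem load_update_le {y : Fin n → Fin T → ℝ} {i : Fin n} {t : Fin T} (hi : y i t = 0)
    {f : Fin T → ℝ} (hy : ∀ j, I.load y t j ≤ I.C j)
    (hf : f t ≤ I.C (I.P i) - I.load y t (I.P i)) (j : Fin m) :
    I.load (Function.update y i f) t j ≤ I.C j := by
  rcases eq_or_ne (I.P i) j with rfl | hj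
  · rw [load, sum_update_row hi f (by simp)]
    rw [load] at hf
    linarith
  · refine le_trans (le_of_eq (Finset.sum_congr rfl fun i' hi' => ?_)) (hy j)
    rw [Function.update_of_ne]
    rintro rfl
    exact hj (mem_filter.1 hi').2

theorem sum_remove (x : Schedule n T) {L A : Finset (Fin n)} (h : L ⊆ A) (t : Fin T) :
    ∑ i ∈ A, (x.remove L).rate i t = ∑ i ∈ A, x.rate i t - ∑ i ∈ L, x.rate i t := by
  rw [← Finset.sum_sdiff h, ← Finset.sum_sdiff h (f := fun i => x.rate i t), add_sub_cancel_right,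
    Finset.sum_eq_zero (s := L) fun i hi => by simp [Schedule.remove, hi], add_zero]
  exact Finset.sum_congr rfl fun i hi => by simp [Schedule.remove, (mem_sdiff.1 hi).2]

theorem load_le_sum {y : Fin n → Fin T → ℝ} (hy : ∀ i t, 0 ≤ y i t) (t : Fin T) (j : Fin m) :
    I.load y t j ≤ ∑ i, y i t :=
  Finset.sum_le_sum_of_subset_of_nonneg (filter_subset _ _) fun i _ _ => hy i t

/-- What is left of a cap `C` under a load `W` is blocked for the rate `k` at most in the proportion
`W / C`. -/
theorem rate_mul_le_sub {k C c W V : ℝ} (hk : 0 ≤ k) (hkC : k ≤ C) (hc : 0 < c) (hcC : c ≤ C)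
    (hWC : W ≤ C) (hWV : W ≤ V) (hV : 0 ≤ V) : k * (1 - V / c) ≤ C - W := by
  have hC : 0 < C := hc.trans_le hcC
  -- Enlarging the load to `V` and shrinking the cap to `c` only raises the blocked proportion; it
  -- remains to use C - W = C(1 - W/C) and k ≤ C.
  have h1 : W / C ≤ V / c :=
    (div_le_div_of_nonneg_right hWV hC.le).trans (div_le_div_of_nonneg_left hV hc hcC)
  have h2 : C * (1 - W / C) = C - W := by field_simp
  rw [← h2]
  have h3 : 0 ≤ 1 - W / C := by
    rw [sub_nonneg, div_le_one hC]
    exact hWC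
  exact (mul_le_mul_of_nonneg_left (by linarith) hk).trans (mul_le_mul_of_nonneg_right hkC h3)

theorem isAvailability_localAvail (hK : ∀ j, I.K j < I.C j) :
    I.IsAvailability I.localAvail I.RespectsLocalCaps I.C where
  zero t j := by simpa [load] using (I.C_pos j).le
  nonneg x hx t j := sub_nonneg.2 (hx t j)
  mono y y' hy h t j := (load_mono h t j).trans (hy t j)
  update x i f hx hi hf t := load_update_le (hi t) (hx t) (hf t)
  remove x L t j hL := by
    simp only [localAvail, load]
    rw [sum_remove x fun i hi => mem_filter.2 ⟨mem_univ i, hL i hi⟩]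
    ring
  cap_pos := I.C_pos
  blocking x i t hx h0 := by
    have hV : 0 ≤ ∑ i', x.rate i' t := Finset.sum_nonneg fun i' _ => h0 i' t
    refine le_min (rate_mul_le_sub (I.k_pos i).le ((k_le_K i).trans (hK _).le) (I.C_pos _) le_rfl
      (hx t _) (load_le_sum h0 t _) hV) ?_
    refine mul_le_of_le_one_right (I.k_pos i).le ?_
    linarith [div_nonneg hV (I.C_pos (I.P i)).le]

/-- The minimum of the two caps is small enough to serve in the blocking bound for either cap. The
global cap can be used up by other stations, which is why `blocking` measures the load of all
stations; it also needs k_i ≤ C_total. -/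
theorem isAvailability_globalAvail (hK : ∀ j, I.K j < I.C j) (hk : ∀ i, I.k i ≤ I.Ctotal) :
    I.IsAvailability I.globalAvail (fun y => I.RespectsLocalCaps y ∧ I.RespectsGlobalCap y)
      fun j => min (I.C j) I.Ctotal where
  zero := ⟨fun t j => by simpa [load] using (I.C_pos j).le, fun t => by
    simpa using I.Ctotal_pos.le⟩
  nonneg x hx t j := le_min (sub_nonneg.2 (hx.1 t j)) (sub_nonneg.2 (hx.2 t))
  mono y y' hy h := ⟨fun t j => (load_mono h t j).trans (hy.1 t j),
    fun t => (Finset.sum_le_sum fun i _ => h i t).trans (hy.2 t)⟩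
  update x i f hx hi hf := by
    refine ⟨fun t => load_update_le (hi t) (hx.1 t) ((hf t).trans (min_le_left _ _)), fun t => ?_⟩
    rw [sum_update_row (hi t) f (mem_univ i)]
    linarith [(hf t).trans (min_le_right _ _)]
  remove x L t j hL := by
    simp only [globalAvail, load]
    rw [sum_remove x fun i hi => mem_filter.2 ⟨mem_univ i, hL i hi⟩, sum_remove x (subset_univ L),
      ← min_add_add_right]
    congr 1 <;> ring
  cap_pos j := lt_min (I.C_pos j) I.Ctotal_pos
  blocking x i t hx h0 := by
    have hV : 0 ≤ ∑ i', x.rate i' t := Finset.sum_nonneg fun i' _ => h0 i' t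
    have hc : 0 < min (I.C (I.P i)) I.Ctotal := lt_min (I.C_pos _) I.Ctotal_pos
    refine le_min (le_min ?_ ?_) ?_
    · exact rate_mul_le_sub (I.k_pos i).le ((k_le_K i).trans (hK _).le) hc (min_le_left _ _)
        (hx.1 t _) (load_le_sum h0 t _) hV
    · exact rate_mul_le_sub (I.k_pos i).le (hk i) hc (min_le_right _ _) (hx.2 t) le_rfl hV
    · refine mul_le_of_le_one_right (I.k_pos i).le ?_
      linarith [div_nonneg hV hc.le]

theorem RespectsLocalCaps.respectsGlobalCap {y : Fin n → Fin T → ℝ} (hy : I.RespectsLocalCaps y)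
    (hC : ∑ j, I.C j ≤ I.Ctotal) : I.RespectsGlobalCap y := by
  intro t
  rw [← Finset.sum_fiberwise _ I.P]
  exact (Finset.sum_le_sum fun j _ => hy t j).trans hC

end Instance

end EVCharging

/-! ### The guarantee for rules (G) and (L) -/

theorem theorem4p1 {n m T : ℕ} (I : EVCharging.Instance n m T) (hs : 1 < I.s)
    (hK : ∀ j, I.K j < I.C j) (order : List (Fin n)) (horder : I.IsSortedOrder order) :
    -- availability bounded by the local and the global cap
    ((∀ i, I.k i ≤ I.Ctotal) →
      I.IsFeasible (I.scs I.globalAvail order) ∧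
      (∀ x, I.IsFeasible x → I.revenue x ≤ I.ratio * I.revenue (I.scs I.globalAvail order)) ∧
      (∀ y, I.IsLPFeasible y → I.lpValue y ≤ I.ratio * I.revenue (I.scs I.globalAvail order))) ∧
    -- availability bounded by the local cap only
    (I.ServesSelected (I.scs I.localAvail order) ∧
      I.RespectsLocalCaps (I.scs I.localAvail order).rate ∧
      (∑ j, I.C j ≤ I.Ctotal → I.IsFeasible (I.scs I.localAvail order)) ∧
      (∀ x, I.IsFeasible x → I.revenue x ≤ I.ratio * I.revenue (I.scs I.localAvail order)) ∧
      (∀ y, I.IsLPFeasible y → I.lpValue y ≤ I.ratio * I.revenue (I.scs I.localAvail order))) := by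
  refine ⟨fun hk => ?_, ?_⟩
  · obtain ⟨h1, ⟨h2, h3⟩, h4, h5⟩ := (EVCharging.Instance.isAvailability_globalAvail hK hk).scs hs hK
      (fun y hy t j => le_min (hy.localCaps t j)
        ((EVCharging.Instance.load_le_sum hy.nonneg t j).trans (hy.globalCap t))) horder
    exact ⟨⟨h1, h2, h3⟩, h4, h5⟩
  · obtain ⟨h1, h2, h3, h4⟩ := (EVCharging.Instance.isAvailability_localAvail hK).scs hs hK
      (fun y hy => hy.localCaps) horder
    exact ⟨h1, h2, fun hC => ⟨h1, h2, h2.respectsGlobalCap hC⟩, h3, h4⟩
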